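/- **Proposition (stability of (NL) under extensions).** A *hyperbolic space* is a geodesic metric space (not necessarily proper) that is Gromov hyperbolic: for some $\delta\ge 0$, $(x\mid z)_w\ge\min\{(x\mid y)_w,(y\mid z)_w\}-\delta$ for all points $w,x,y,z$, where $(x\mid y)_w=\tfrac12\big(d(x,w)+d(y,w)-d(x,y)\big)$. If a group $G$ acts by isometries on a hyperbolic space $X$, an element $g\in G$ is *loxodromic* if the map $\mathbb Z\to X$, $n\mapsto g^n x$, is a quasi-isometric embedding for some (equivalently, every) $x\in X$. A group has *Property $\mathrm{(NL)}$* if no action of it by isometries on a hyperbolic space has a loxodromic element, and it is *hereditary $\mathrm{(NL)}$* if all of its finite-index subgroups have Property $\mathrm{(NL)}$. Let $1\to N\to G\to Q\to 1$ be a short exact sequence of groups. 1. If $N$ and $Q$ both have Property $\mathrm{(NL)}$, then $G$ has Property $\mathrm{(NL)}$. 2. If $N$ and $Q$ are both hereditary $\mathrm{(NL)}$, then $G$ is hereditary $\mathrm{(NL)}$. -/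

import Mathlib

universe u

/-- A metric space is geodesic if any two points `x`, `y` are joined by an isometrically embedded
copy of the interval `[0, dist x y]`. -/
def IsGeodesicSpace (X : Type u) [MetricSpace X] : Prop :=
  ∀ x y : X, ∃ γ : ℝ → X, γ 0 = x ∧ γ (dist x y) = y ∧
    ∀ s ∈ Set.Icc (0 : ℝ) (dist x y), ∀ t ∈ Set.Icc (0 : ℝ) (dist x y),
      dist (γ s) (γ t) = |s - t|

/-- The Gromov product `(x | y)_w` of `x` and `y` based at `w`. -/
noncomputable def gromovProduct {X : Type u} [MetricSpace X] (w x y : X) : ℝ :=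
  (dist x w + dist y w - dist x y) / 2

/-- A (Gromov) hyperbolic space: a geodesic metric space, not assumed proper, in which Gromov's
inequality `(x | z)_w ≥ min (x | y)_w (y | z)_w - δ` holds for some constant `δ`. -/
def IsHyperbolicSpace (X : Type u) [MetricSpace X] : Prop :=
  IsGeodesicSpace X ∧
    ∃ δ : ℝ, 0 ≤ δ ∧ ∀ w x y z : X,
      min (gromovProduct w x y) (gromovProduct w y z) - δ ≤ gromovProduct w x z

/-- `f` is a quasi-isometric embedding: distances are distorted by at most a multiplicative
constant `K` and an additive constant `C`. -/
def IsQuasiIsometricEmbedding {A B : Type*} [MetricSpace A] [MetricSpace B] (f : A → B) : Prop :=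
  ∃ K C : ℝ, 1 ≤ K ∧ 0 ≤ C ∧ ∀ a b : A,
    K⁻¹ * dist a b - C ≤ dist (f a) (f b) ∧ dist (f a) (f b) ≤ K * dist a b + C

/-- The element `g` acts loxodromically on `X`: for some point `x`, the orbit map `n ↦ gⁿ x` from
the integers to `X` is a quasi-isometric embedding. -/
def IsLoxodromicOn {G : Type u} [Group G] (X : Type u) [MetricSpace X] [MulAction G X] (g : G) :
    Prop :=
  ∃ x : X, IsQuasiIsometricEmbedding (fun n : ℤ => g ^ n • x)

/-- Property (NL), "no loxodromics": no action of `G` by isometries on a hyperbolic space has a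
loxodromic element. -/
def PropertyNL (G : Type u) [Group G] : Prop :=
  ∀ (X : Type u) [MetricSpace X] [MulAction G X] [IsIsometricSMul G X],
    IsHyperbolicSpace X → ∀ g : G, ¬ IsLoxodromicOn X g

/-- Hereditary (NL): all finite-index subgroups have (NL). -/
def HereditaryNL (G : Type u) [Group G] : Prop :=
  ∀ H : Subgroup G, H.FiniteIndex → PropertyNL H

/-! (NL) is equivalent to `SquaringBounded`: for each hyperbolic length `ℓ`, the excess `ℓ (g * g) -
ℓ g` is bounded above. If the excess is large for some `g`, the four-point condition makes `ℓ (g ^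
n)` grow linearly, and the tight span of `(G, ℓ)` is a geodesic hyperbolic space on which `g` is
loxodromic. Conversely, bounded excess gives `ℓ (g ^ 2 ^ i)` at most linear growth in `i`, which
rules out loxodromics.

For an extension, let `ℓ` be a hyperbolic length on `G`. If it is bounded on the kernel, it descends
coarsely to `Q`. Otherwise the kernel has a single limit point at infinity, which `G` fixes by
normality, and the Busemann function there is a quasimorphism `φ` (`busemann_quasimorphism`). Its
absolute value is again a coarse hyperbolic length and nearly doubles under squaring, so the
hypotheses bound it on the kernel and then on `G`. An element of large excess would make `φ`
unbounded (`exists_lt_abs_busemann`). -/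

/-! ### The tight span and its four-point condition -/

/-- The tight span (injective hull) of a pseudometric space. -/
structure TightSpan (X : Type u) [PseudoMetricSpace X] : Type u where
  /-- The underlying function. -/
  toFun : X → ℝ
  dist_le_add' : ∀ x y, dist x y ≤ toFun x + toFun y
  exists_add_le' : ∀ x, ∀ ε > 0, ∃ y, toFun x + toFun y ≤ dist x y + ε

namespace TightSpan

variable {X : Type u} [PseudoMetricSpace X]

instance : CoeFun (TightSpan X) (fun _ => X → ℝ) := ⟨toFun⟩

@[ext] theorem ext {e f : TightSpan X} (h : ∀ x, e x = f x) : e = f := by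
  cases e
  cases f
  congr
  exact funext h

theorem dist_le_add (f : TightSpan X) (x y : X) : dist x y ≤ f x + f y := f.dist_le_add' x y

theorem exists_add_le (f : TightSpan X) (x : X) {ε : ℝ} (hε : 0 < ε) :
    ∃ y, f x + f y ≤ dist x y + ε := f.exists_add_le' x ε hε

theorem le_dist_add (f : TightSpan X) (x y : X) : f x ≤ dist x y + f y := by
  refine le_of_forall_pos_le_add fun ε hε => ?_
  obtain ⟨z, hz⟩ := f.exists_add_le x hε
  linarith [f.dist_le_add y z, dist_triangle x y z]

/-- Keeps the supremum distance finite even when `X` is unbounded. -/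
theorem abs_sub_le_add (e f : TightSpan X) (y x : X) : |e x - f x| ≤ e y + f y := by
  rw [abs_le]
  constructor <;>
    linarith [e.le_dist_add x y, f.le_dist_add x y, e.dist_le_add x y, f.dist_le_add x y]

noncomputable instance : Dist (TightSpan X) := ⟨fun e f => ⨆ x, |e x - f x|⟩

theorem dist_def (e f : TightSpan X) : dist e f = ⨆ x, |e x - f x| := rfl

theorem abs_sub_le_dist (e f : TightSpan X) (x : X) : |e x - f x| ≤ dist e f :=
  le_ciSup (f := fun x => |e x - f x|)
    ⟨e x + f x, by rintro _ ⟨z, rfl⟩; exact abs_sub_le_add e f x z⟩ x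

theorem dist_le {e f : TightSpan X} {c : ℝ} (hc : 0 ≤ c) (h : ∀ x, |e x - f x| ≤ c) :
    dist e f ≤ c :=
  Real.iSup_le h hc

protected theorem dist_nonneg (e f : TightSpan X) : 0 ≤ dist e f :=
  Real.iSup_nonneg fun _ => abs_nonneg _

theorem le_add_dist (e f : TightSpan X) (x : X) : f x ≤ e x + dist e f := by
  linarith [(abs_le.1 (abs_sub_le_dist e f x)).1]

noncomputable instance : MetricSpace (TightSpan X) where
  dist_self f := le_antisymm (dist_le le_rfl fun x => by simp) (TightSpan.dist_nonneg f f)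
  dist_comm e f := by simp only [dist_def, abs_sub_comm]
  dist_triangle e f g := dist_le (add_nonneg (TightSpan.dist_nonneg _ _)
    (TightSpan.dist_nonneg _ _)) fun x => (abs_sub_le _ (f x) _).trans
      (add_le_add (abs_sub_le_dist e f x) (abs_sub_le_dist f g x))
  eq_of_dist_eq_zero {e f} h := by
    ext x
    have := abs_sub_le_dist e f x
    rw [h] at this
    exact sub_eq_zero.1 (abs_eq_zero.1 (le_antisymm this (abs_nonneg _)))

/-- The distance between two points of the tight span is approximated by distances in the
original space. -/
theorem exists_dist_le [Nonempty X] (e f : TightSpan X) {ε : ℝ} (hε : 0 < ε) :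
    ∃ x y, dist e f ≤ dist x y - e x - f y + ε := by
  obtain ⟨x, hx⟩ : ∃ x, dist e f - ε / 2 < |e x - f x| :=
    exists_lt_of_lt_ciSup (by rw [← dist_def]; linarith)
  rcases abs_cases (e x - f x) with ⟨h, -⟩ | ⟨h, -⟩
  · obtain ⟨y, hy⟩ := e.exists_add_le x (half_pos hε)
    exact ⟨y, x, by rw [dist_comm y x]; linarith⟩
  · obtain ⟨y, hy⟩ := f.exists_add_le x (half_pos hε)
    exact ⟨x, y, by linarith⟩

theorem dist_le_add_dist_add (e f : TightSpan X) (x y : X) :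
    dist x y ≤ e x + dist e f + f y := by
  linarith [f.dist_le_add x y, le_add_dist e f x]

/-- Replace both distances on the left by nearly optimal pairs in `X`. The values of `e`, `f`, `g`,
`h` at these points cancel, so `δ` is unchanged. -/
theorem four_point [Nonempty X] {δ : ℝ}
    (hX : ∀ x y z w : X, dist x y + dist z w ≤ max (dist x z + dist y w) (dist y z + dist x w) + δ)
    (e f g h : TightSpan X) :
    dist e f + dist g h ≤ max (dist e g + dist f h) (dist f g + dist e h) + δ := by
  refine le_of_forall_pos_le_add fun ε hε => ?_
  obtain ⟨x, y, hxy⟩ := exists_dist_le e f (half_pos hε)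
  obtain ⟨z, w, hzw⟩ := exists_dist_le g h (half_pos hε)
  rcases le_max_iff.1 (sub_le_iff_le_add.2 (hX x y z w)) with H | H
  · linarith [dist_le_add_dist_add e g x z, dist_le_add_dist_add f h y w,
      le_max_left (dist e g + dist f h) (dist f g + dist e h)]
  · linarith [dist_le_add_dist_add f g y z, dist_le_add_dist_add e h x w,
      le_max_right (dist e g + dist f h) (dist f g + dist e h)]

/-- The Kuratowski embedding of a space into its tight span. -/
def kuratowski (x : X) : TightSpan X :=
  ⟨fun y => dist x y, fun y z => dist_triangle_left y z x, fun y ε hε => ⟨x, by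
    rw [dist_self, dist_comm y x]; linarith⟩⟩

theorem dist_kuratowski (x y : X) : dist (kuratowski x) (kuratowski y) = dist x y := by
  refine le_antisymm (dist_le dist_nonneg fun z => abs_dist_sub_le x y z) ?_
  have := abs_sub_le_dist (kuratowski x) (kuratowski y) y
  simpa [kuratowski] using this

/-! ### The 1-Lipschitz retraction onto the tight span -/

section Retraction

/-- The functions dominating the metric, among which the tight span consists of the minimal
ones. -/
def Dominating (f : X → ℝ) : Prop := ∀ x y, dist x y ≤ f x + f y

/-- The conjugate `x ↦ sup_y (d(x, y) - f(y))`. -/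
noncomputable def conj (f : X → ℝ) (x : X) : ℝ := ⨆ y, (dist x y - f y)

theorem Dominating.nonneg {f : X → ℝ} (hf : Dominating f) (x : X) : 0 ≤ f x := by
  linarith [hf x x, dist_self x]

theorem Dominating.le_conj {f : X → ℝ} (hf : Dominating f) (x y : X) :
    dist x y - f y ≤ conj f x :=
  le_ciSup (f := fun y => dist x y - f y)
    ⟨f x, by rintro _ ⟨z, rfl⟩; linarith [hf x z]⟩ y

theorem conj_le {f : X → ℝ} {x : X} {c : ℝ} (h : ∀ y, dist x y - f y ≤ c) : conj f x ≤ c :=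
  have : Nonempty X := ⟨x⟩
  ciSup_le h

theorem Dominating.conj_le_self {f : X → ℝ} (hf : Dominating f) (x : X) : conj f x ≤ f x :=
  conj_le fun y => by linarith [hf x y]

/-- The average of a function and its conjugate. -/
noncomputable def avg (f : X → ℝ) (x : X) : ℝ := (f x + conj f x) / 2

/-- The required inequality holds with either one of the two terms conjugated; average the two
versions. -/
theorem Dominating.avg {f : X → ℝ} (hf : Dominating f) : Dominating (avg f) := fun x y => by
  have h1 := hf.le_conj x y
  have h2 := hf.le_conj y x
  rw [dist_comm] at h2
  simp only [TightSpan.avg]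
  linarith

theorem Dominating.iterate {f : X → ℝ} (hf : Dominating f) (n : ℕ) :
    Dominating (TightSpan.avg^[n] f) := by
  induction n with
  | zero => exact hf
  | succ n ih => rw [Function.iterate_succ_apply']; exact ih.avg

/-- Conjugation reverses order, hence the two-sided hypothesis. -/
theorem avg_le_avg_add {f g : X → ℝ} {c : ℝ} (hg : Dominating g) (h : ∀ x, f x ≤ g x + c)
    (h' : ∀ x, g x ≤ f x + c) (x : X) : avg f x ≤ avg g x + c := by
  have : conj f x ≤ conj g x + c := conj_le fun y => by linarith [hg.le_conj x y, h' y]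
  simp only [avg]
  linarith [h x]

theorem iterate_le_iterate_add {f g : X → ℝ} {c : ℝ} (hf : Dominating f) (hg : Dominating g)
    (h : ∀ x, f x ≤ g x + c) (h' : ∀ x, g x ≤ f x + c) (n : ℕ) :
    (∀ x, avg^[n] f x ≤ avg^[n] g x + c) ∧ ∀ x, avg^[n] g x ≤ avg^[n] f x + c := by
  induction n with
  | zero => exact ⟨h, h'⟩
  | succ n ih =>
    simp only [Function.iterate_succ_apply']
    exact ⟨avg_le_avg_add (hg.iterate n) ih.1 ih.2, avg_le_avg_add (hf.iterate n) ih.2 ih.1⟩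

/-- The limit of the iterates of `avg`. -/
noncomputable def limAvg (f : X → ℝ) (x : X) : ℝ := ⨅ n : ℕ, avg^[n] f x

theorem Dominating.limAvg_le {f : X → ℝ} (hf : Dominating f) (n : ℕ) (x : X) :
    limAvg f x ≤ TightSpan.avg^[n] f x :=
  ciInf_le (f := fun n : ℕ => TightSpan.avg^[n] f x)
    ⟨0, by rintro _ ⟨m, rfl⟩; exact (hf.iterate m).nonneg x⟩ n

theorem limAvg_le_limAvg_add {f g : X → ℝ} {c : ℝ} (hf : Dominating f) (hg : Dominating g)
    (h : ∀ x, f x ≤ g x + c) (h' : ∀ x, g x ≤ f x + c) (x : X) : limAvg f x ≤ limAvg g x + c := by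
  rw [← sub_le_iff_le_add]
  refine le_ciInf fun n => ?_
  linarith [hf.limAvg_le n x, (iterate_le_iterate_add hf hg h h' n).1 x]

theorem Dominating.antitone_iterate {f : X → ℝ} (hf : Dominating f) (x : X) :
    Antitone fun n : ℕ => TightSpan.avg^[n] f x := antitone_nat_of_succ_le fun n => by
  rw [Function.iterate_succ_apply']
  simp only [TightSpan.avg]
  linarith [(hf.iterate n).conj_le_self x]

/-- The retraction of the dominating functions onto the tight span. -/
noncomputable def retract (f : X → ℝ) (hf : Dominating f) : TightSpan X := by
  refine ⟨limAvg f, fun x y => ?_, fun x ε hε => ?_⟩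
  · refine le_of_forall_pos_le_add fun ε hε => ?_
    obtain ⟨n, hn⟩ := exists_lt_of_ciInf_lt (f := fun n : ℕ => avg^[n] f x)
      (lt_add_of_pos_right (limAvg f x) (half_pos hε))
    obtain ⟨m, hm⟩ := exists_lt_of_ciInf_lt (f := fun n : ℕ => avg^[n] f y)
      (lt_add_of_pos_right (limAvg f y) (half_pos hε))
    linarith [hf.iterate (max n m) x y, hf.antitone_iterate x (le_max_left n m),
      hf.antitone_iterate y (le_max_right n m)]
  · have : Nonempty X := ⟨x⟩
    obtain ⟨n, hn⟩ := exists_lt_of_ciInf_lt (f := fun n : ℕ => avg^[n] f x)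
      (lt_add_of_pos_right (limAvg f x) (half_pos hε))
    have h1 := hf.limAvg_le (n + 1) x
    rw [Function.iterate_succ_apply'] at h1
    simp only [avg] at h1 hn
    obtain ⟨y, hy⟩ := exists_lt_of_lt_ciSup (f := fun y => dist x y - avg^[n] f y)
      (b := limAvg f x - ε) (by change _ < conj (avg^[n] f) x; linarith)
    exact ⟨y, by linarith [hf.limAvg_le n y]⟩

theorem retract_apply (f : X → ℝ) (hf : Dominating f) (x : X) : retract f hf x = limAvg f x := rfl

theorem retract_self (f : TightSpan X) (hf : Dominating f) : retract f hf = f := by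
  have h : avg f = f := funext fun x => by
    have h1 : f x ≤ conj f x := le_of_forall_pos_le_add fun ε hε => by
      obtain ⟨y, hy⟩ := f.exists_add_le x hε
      linarith [hf.le_conj x y]
    have h2 := hf.conj_le_self x
    simp only [avg]
    linarith
  ext x
  simp only [retract_apply, limAvg, Function.iterate_fixed h, ciInf_const]

theorem dist_retract_le {f g : X → ℝ} (hf : Dominating f) (hg : Dominating g) {c : ℝ}
    (hc : 0 ≤ c) (h : ∀ x, |f x - g x| ≤ c) : dist (retract f hf) (retract g hg) ≤ c := by
  have h1 : ∀ x, f x ≤ g x + c := fun x => by linarith [(abs_le.1 (h x)).2]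
  have h2 : ∀ x, g x ≤ f x + c := fun x => by linarith [(abs_le.1 (h x)).1]
  refine dist_le hc fun x => abs_le.2 ⟨?_, ?_⟩ <;> simp only [retract_apply]
  · linarith [limAvg_le_limAvg_add hg hf h2 h1 x]
  · linarith [limAvg_le_limAvg_add hf hg h1 h2 x]

theorem dominating_segment (e f : TightSpan X) (t : Set.Icc (0 : ℝ) 1) :
    Dominating fun x => (1 - t) * e x + t * f x := fun x y => by
  have h1 := mul_le_mul_of_nonneg_left (e.dist_le_add x y) (sub_nonneg.2 t.2.2)
  have h2 := mul_le_mul_of_nonneg_left (f.dist_le_add x y) t.2.1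
  simp only
  linarith

/-- The retraction of the affine segment joining two points of the tight span. -/
noncomputable def segment (e f : TightSpan X) (t : Set.Icc (0 : ℝ) 1) : TightSpan X :=
  retract _ (dominating_segment e f t)

theorem segment_zero (e f : TightSpan X) : segment e f 0 = e := by
  rw [← retract_self e e.dist_le_add]
  simp [segment, retract_self]

theorem segment_one (e f : TightSpan X) : segment e f 1 = f := by
  rw [← retract_self f f.dist_le_add]
  simp [segment, retract_self]

theorem dist_segment_le (e f : TightSpan X) (s t : Set.Icc (0 : ℝ) 1) :
    dist (segment e f s) (segment e f t) ≤ |(s : ℝ) - t| * dist e f := by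
  refine dist_retract_le _ _ (by positivity) fun x => ?_
  have h : (1 - (s : ℝ)) * e x + s * f x - ((1 - t) * e x + t * f x) =
    -((s - t) * (e x - f x)) := by ring
  rw [h, abs_neg, abs_mul]
  exact mul_le_mul_of_nonneg_left (abs_sub_le_dist e f x) (abs_nonneg _)

end Retraction

/-! ### Geodesics and hyperbolicity of the tight span -/

/-- The retraction fixes the ends of an affine segment and does not stretch it. A 1-Lipschitz path
on `[0, D]` with ends at distance `D` is geodesic. -/
theorem isGeodesicSpace : IsGeodesicSpace (TightSpan X) := by
  intro e f
  rcases eq_or_ne e f with rfl | hne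
  · refine ⟨fun _ => e, rfl, rfl, fun s hs t ht => ?_⟩
    rw [dist_self] at hs ht ⊢
    rw [le_antisymm hs.2 hs.1, le_antisymm ht.2 ht.1]
    simp
  have hD : 0 < dist e f := dist_pos.2 hne
  set D := dist e f with hDdef
  have hmem : ∀ s ∈ Set.Icc (0 : ℝ) D, s / D ∈ Set.Icc (0 : ℝ) 1 := fun s hs =>
    ⟨div_nonneg hs.1 hD.le, (div_le_one hD).2 hs.2⟩
  let γ : ℝ → TightSpan X := fun s => segment e f (Set.projIcc (0 : ℝ) 1 zero_le_one (s / D))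
  have hlip : ∀ s ∈ Set.Icc (0 : ℝ) D, ∀ t ∈ Set.Icc (0 : ℝ) D,
      dist (γ s) (γ t) ≤ |s - t| := fun s hs t ht => by
    refine (dist_segment_le _ _ _ _).trans_eq ?_
    rw [Set.projIcc_of_mem _ (hmem s hs), Set.projIcc_of_mem _ (hmem t ht), ← sub_div, abs_div,
      abs_of_pos hD, ← hDdef, div_mul_cancel₀ _ hD.ne']
  have h0 : γ 0 = e := by
    simp only [γ, zero_div]
    rw [Set.projIcc_left]
    exact segment_zero e f
  have h1 : γ D = f := by
    simp only [γ, div_self hD.ne']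
    rw [Set.projIcc_right]
    exact segment_one e f
  have key : ∀ s ∈ Set.Icc (0 : ℝ) D, ∀ t ∈ Set.Icc (0 : ℝ) D, s ≤ t →
      dist (γ s) (γ t) = |s - t| := fun s hs t ht hst => by
    refine le_antisymm (hlip s hs t ht) ?_
    have a := hlip 0 ⟨le_rfl, hD.le⟩ s hs
    have b := hlip t ht D ⟨hD.le, le_rfl⟩
    rw [h0, abs_sub_comm, sub_zero, abs_of_nonneg hs.1] at a
    rw [h1, abs_sub_comm, abs_of_nonneg (sub_nonneg.2 ht.2)] at b
    rw [abs_sub_comm, abs_of_nonneg (sub_nonneg.2 hst)]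
    linarith [dist_triangle e (γ s) f, dist_triangle (γ s) (γ t) f]
  refine ⟨γ, h0, h1, fun s hs t ht => ?_⟩
  rcases le_total s t with h | h
  · exact key s hs t ht h
  · rw [dist_comm, abs_sub_comm, key t ht s hs h]

theorem isHyperbolicSpace [Nonempty X] {δ : ℝ} (hδ : 0 ≤ δ)
    (hX : ∀ x y z w : X, dist x y + dist z w ≤ max (dist x z + dist y w) (dist y z + dist x w) + δ) :
    IsHyperbolicSpace (TightSpan X) := by
  refine ⟨isGeodesicSpace, δ, hδ, fun w x y z => ?_⟩
  have := four_point hX x z y w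
  simp only [gromovProduct]
  rw [dist_comm z y] at this
  rcases le_max_iff.1 (sub_le_iff_le_add.2 this) with H | H
  · linarith [min_le_left ((dist x w + dist y w - dist x y) / 2)
      ((dist y w + dist z w - dist y z) / 2)]
  · linarith [min_le_right ((dist x w + dist y w - dist x y) / 2)
      ((dist y w + dist z w - dist y z) / 2)]

/-! ### The induced isometric action -/

section Action

variable {G : Type*} [Group G] [MulAction G X] [IsIsometricSMul G X]

instance : MulAction G (TightSpan X) where
  smul g f := ⟨fun x => f (g⁻¹ • x), fun x y => by
      rw [← dist_smul g⁻¹ x y]; exact f.dist_le_add _ _, fun x ε hε => by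
      obtain ⟨y, hy⟩ := f.exists_add_le (g⁻¹ • x) hε
      exact ⟨g • y, by simpa only [inv_smul_smul, ← dist_smul g⁻¹ x] using hy⟩⟩
  one_smul f := ext fun x => by
    change f ((1 : G)⁻¹ • x) = f x
    simp
  mul_smul g h f := ext fun x => by
    change f ((g * h)⁻¹ • x) = f (h⁻¹ • g⁻¹ • x)
    rw [mul_inv_rev, mul_smul]

theorem smul_apply (g : G) (f : TightSpan X) (x : X) : (g • f) x = f (g⁻¹ • x) := rfl

instance : IsIsometricSMul G (TightSpan X) := ⟨fun g => Isometry.of_dist_eq fun e f => by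
  refine le_antisymm (dist_le dist_nonneg fun x => abs_sub_le_dist e f _)
    (dist_le dist_nonneg fun x => ?_)
  have := abs_sub_le_dist (g • e) (g • f) (g • x)
  simpa only [smul_apply, inv_smul_smul] using this⟩

theorem smul_kuratowski (g : G) (x : X) : g • kuratowski x = kuratowski (g • x) := ext fun y => by
  change dist x (g⁻¹ • y) = dist (g • x) y
  rw [← dist_smul g, smul_inv_smul]

end Action

end TightSpan

/-! ### Hyperbolic lengths and growth under squaring -/

/-- A length function on a group whose associated left-invariant pseudometric `ℓ (x⁻¹ * y)`
satisfies the four-point condition with constant `δ`. -/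
structure IsHyperbolicLength {G : Type*} [Group G] (ℓ : G → ℝ) (δ : ℝ) : Prop where
  one : ℓ 1 = 0
  inv : ∀ g, ℓ g⁻¹ = ℓ g
  mul_le : ∀ g h, ℓ (g * h) ≤ ℓ g + ℓ h
  four_point : ∀ x y z, ℓ (x⁻¹ * y) + ℓ z ≤ ℓ (x⁻¹ * z) + ℓ y + δ ∨
    ℓ (x⁻¹ * y) + ℓ z ≤ ℓ (y⁻¹ * z) + ℓ x + δ

/-- A function on a group satisfying the axioms of a hyperbolic length up to an additive
constant. -/
structure IsCoarseHyperbolicLength {G : Type*} [Group G] (ℓ : G → ℝ) (C : ℝ) : Prop where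
  inv_le : ∀ g, ℓ g⁻¹ ≤ ℓ g + C
  mul_le : ∀ g h, ℓ (g * h) ≤ ℓ g + ℓ h + C
  four_point : ∀ x y z, ℓ (x⁻¹ * y) + ℓ z ≤ ℓ (x⁻¹ * z) + ℓ y + C ∨
    ℓ (x⁻¹ * y) + ℓ z ≤ ℓ (y⁻¹ * z) + ℓ x + C

/-- Every hyperbolic length on the group grows by a bounded amount under squaring. -/
def SquaringBounded (G : Type*) [Group G] : Prop :=
  ∀ (ℓ : G → ℝ) (δ : ℝ), IsHyperbolicLength ℓ δ → ∃ L, ∀ g, ℓ (g * g) ≤ ℓ g + L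

/-- Twice the Gromov product based at the identity. -/
def doubleProduct {G : Type*} [Group G] (ℓ : G → ℝ) (x y : G) : ℝ := ℓ x + ℓ y - ℓ (x⁻¹ * y)

namespace IsHyperbolicLength

variable {G : Type*} [Group G] {ℓ : G → ℝ} {δ : ℝ}

theorem nonneg (h : IsHyperbolicLength ℓ δ) (g : G) : 0 ≤ ℓ g := by
  have := h.mul_le g g⁻¹
  rw [mul_inv_cancel, h.one, h.inv] at this
  linarith

theorem const_nonneg (h : IsHyperbolicLength ℓ δ) : 0 ≤ δ := by
  rcases h.four_point 1 1 1 with H | H <;> simp [h.one] at H <;> exact H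

theorem inv_mul_comm (h : IsHyperbolicLength ℓ δ) (x y : G) : ℓ (x⁻¹ * y) = ℓ (y⁻¹ * x) := by
  rw [← h.inv, mul_inv_rev, inv_inv]

theorem le_mul_add (h : IsHyperbolicLength ℓ δ) (x y : G) : ℓ y ≤ ℓ (x⁻¹ * y) + ℓ x := by
  have := h.mul_le x (x⁻¹ * y)
  rw [mul_inv_cancel_left] at this
  linarith

theorem comp {H : Type*} [Group H] (h : IsHyperbolicLength ℓ δ) (φ : H →* G) :
    IsHyperbolicLength (fun x => ℓ (φ x)) δ where
  one := by simp [h.one]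
  inv g := by simp [h.inv]
  mul_le g k := by simpa using h.mul_le (φ g) (φ k)
  four_point x y z := by simpa using h.four_point (φ x) (φ y) (φ z)

theorem doubleProduct_comm (h : IsHyperbolicLength ℓ δ) (x y : G) :
    doubleProduct ℓ x y = doubleProduct ℓ y x := by
  simp only [doubleProduct, h.inv_mul_comm x y]
  ring

theorem doubleProduct_ge (h : IsHyperbolicLength ℓ δ) (x y z : G) :
    doubleProduct ℓ x y - δ ≤ doubleProduct ℓ x z ∨
      doubleProduct ℓ y z - δ ≤ doubleProduct ℓ x z := by
  have h1 := h.inv_mul_comm z y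
  rcases h.four_point x z y with H | H
  · left; simp only [doubleProduct]; linarith
  · right; simp only [doubleProduct]; linarith

/-- If the length of `g` increases sufficiently under squaring, then the lengths of the powers of
`g` grow linearly. -/
theorem pow_succ_ge (h : IsHyperbolicLength ℓ δ) {g : G} {L : ℝ} (hL : δ ≤ L)
    (hg : ℓ g + L < ℓ (g * g)) (n : ℕ) : ℓ (g ^ n) + (L - δ) ≤ ℓ (g ^ (n + 1)) := by
  have h0 := h.const_nonneg
  induction n with
  | zero =>
    have := h.mul_le g g
    simp only [pow_zero, h.one, zero_add, pow_one]
    linarith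
  | succ n ih =>
    have e1 : (g * g)⁻¹ * g ^ (n + 2) = g ^ n := by rw [pow_add, pow_two]; group
    have e2 : g⁻¹ * g ^ (n + 2) = g ^ (n + 1) := by group
    have e3 : g⁻¹ * (g * g) = g := by group
    have e4 : (g ^ (n + 2))⁻¹ * g = (g ^ (n + 1))⁻¹ := by group
    have e5 : (g ^ (n + 2))⁻¹ * (g * g) = (g ^ n)⁻¹ := by rw [pow_add, pow_two]; group
    -- The first alternative would make `ℓ (g ^ (n + 1))` too small for the induction hypothesis;
    -- the second is the next increment.
    have H := h.four_point (g ^ (n + 2)) g (g * g)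
    rw [e4, e5, e3, h.inv, h.inv] at H
    rcases H with H | H <;> linarith

theorem pow_ge (h : IsHyperbolicLength ℓ δ) {g : G} {L : ℝ} (hL : δ ≤ L)
    (hg : ℓ g + L < ℓ (g * g)) (n : ℕ) : n * (L - δ) ≤ ℓ (g ^ n) := by
  induction n with
  | zero => simp [h.one]
  | succ n ih =>
    have := h.pow_succ_ge hL hg n
    push_cast
    linarith

/-- The positive and negative powers of an element whose length increases sufficiently under
squaring have bounded Gromov product. -/
theorem doubleProduct_pow_le (h : IsHyperbolicLength ℓ δ) {g : G} {L : ℝ} (hL : 2 * δ ≤ L)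
    (hg : ℓ g + L < ℓ (g * g)) (n m : ℕ) :
    doubleProduct ℓ ((g ^ (n + 1))⁻¹) (g ^ (m + 1)) ≤ ℓ g + 2 * δ := by
  have h0 := h.const_nonneg
  have key : ∀ k : ℕ, ℓ g + L - δ ≤ doubleProduct ℓ g (g ^ (k + 1)) := fun k => by
    have e : g⁻¹ * g ^ (k + 1) = g ^ k := by group
    have := h.pow_succ_ge (by linarith) hg k
    simp only [doubleProduct, e]
    linarith
  have key' : ∀ k : ℕ, ℓ g + L - δ ≤ doubleProduct ℓ g⁻¹ ((g ^ (k + 1))⁻¹) := fun k => by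
    have e : g⁻¹⁻¹ * (g ^ (k + 1))⁻¹ = (g ^ k)⁻¹ := by group
    have := h.pow_succ_ge (by linarith) hg k
    simp only [doubleProduct, e, h.inv]
    linarith
  have e : doubleProduct ℓ g⁻¹ g = 2 * ℓ g - ℓ (g * g) := by
    simp only [doubleProduct, inv_inv, h.inv]; ring
  -- Otherwise consecutive products in the chain `g⁻¹`, negative power, positive power, `g` are all
  -- large, against `doubleProduct ℓ g⁻¹ g < ℓ g - L`.
  by_contra! hlt
  have k1 := key m
  rw [h.doubleProduct_comm] at k1
  have k2 := key' n
  rcases h.doubleProduct_ge g⁻¹ (g ^ (m + 1)) g with H | H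
  · rcases h.doubleProduct_ge g⁻¹ ((g ^ (n + 1))⁻¹) (g ^ (m + 1)) with H' | H' <;> linarith
  · linarith

/-- If the lengths of `a`, `b` and `a * b` grow little under squaring, then the Gromov product of
`a` and `b` is large. -/
theorem min_sub_le_doubleProduct (h : IsHyperbolicLength ℓ δ) {a b : G} {L : ℝ} (hL : 0 ≤ L)
    (ha : ℓ (a * a) ≤ ℓ a + L) (hb : ℓ (b * b) ≤ ℓ b + L)
    (hab : ℓ (a * b * (a * b)) ≤ ℓ (a * b) + L) :
    min (ℓ a) (ℓ b) - (L + 2 * δ) ≤ doubleProduct ℓ a b := by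
  have h0 := h.const_nonneg
  by_contra! hlt
  -- Small excess means that `c` and `c⁻¹` point in nearly the same direction.
  have sq : ∀ c, ℓ (c * c) ≤ ℓ c + L → ℓ c - L ≤ doubleProduct ℓ c c⁻¹ := fun c hc => by
    have e : ℓ (c⁻¹ * c⁻¹) = ℓ (c * c) := by rw [← mul_inv_rev, h.inv]
    simp only [doubleProduct, e, h.inv]
    linarith
  have ma := min_le_left (ℓ a) (ℓ b)
  have mb := min_le_right (ℓ a) (ℓ b)
  have p1 : doubleProduct ℓ a⁻¹ b < min (ℓ a) (ℓ b) - (L + δ) := by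
    have := sq a ha
    rcases h.doubleProduct_ge a a⁻¹ b with H | H <;> linarith
  have p2 : doubleProduct ℓ a b⁻¹ < min (ℓ a) (ℓ b) - (L + δ) := by
    have := sq b hb
    rw [h.doubleProduct_comm] at this
    rcases h.doubleProduct_ge a b⁻¹ b with H | H <;> linarith
  have e0 : ℓ (a * b) = ℓ a + ℓ b - doubleProduct ℓ a⁻¹ b := by
    simp only [doubleProduct, h.inv, inv_inv]; ring
  have e1 : doubleProduct ℓ a (a * b) = ℓ a + ℓ (a * b) - ℓ b := by
    simp [doubleProduct]
  have e2 : doubleProduct ℓ ((a * b)⁻¹) b⁻¹ = ℓ b + ℓ (a * b) - ℓ a := by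
    simp only [doubleProduct, h.inv, inv_inv, mul_inv_cancel_right]; ring
  have e3 := sq (a * b) hab
  -- By `p1` the product `a * b` is long, so the chain `a`, `a * b`, `(a * b)⁻¹`, `b⁻¹` has large
  -- consecutive products, contradicting `p2`.
  rcases h.doubleProduct_ge a (a * b) b⁻¹ with H | H
  · linarith
  · rcases h.doubleProduct_ge (a * b) (a * b)⁻¹ b⁻¹ with H' | H' <;> linarith

/-- If `u` and `v` fellow-travel from the identity up to distance `ℓ g`, they give the same Busemann
value at `g` up to `δ`. In the second four-point alternative the left side is at most `δ - ℓ g`,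
while the difference for `v` is at least `-ℓ g`. -/
theorem sub_le_sub_of_far (h : IsHyperbolicLength ℓ δ) {g u v : G}
    (huv : ℓ (u⁻¹ * v) + 2 * ℓ g ≤ ℓ u + ℓ v) :
    ℓ (g⁻¹ * u) - ℓ u ≤ ℓ (g⁻¹ * v) - ℓ v + δ := by
  have h0 := h.const_nonneg
  have := h.le_mul_add g v
  rcases h.four_point g u v with H | H <;> linarith

end IsHyperbolicLength

/-! ### Coarse lengths and descent to a quotient -/

namespace IsCoarseHyperbolicLength

variable {G : Type*} [Group G] {ℓ : G → ℝ} {C : ℝ}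

theorem const_nonneg (h : IsCoarseHyperbolicLength ℓ C) : 0 ≤ C := by
  have := h.inv_le 1
  rw [inv_one] at this
  linarith

open Classical in
/-- A coarse hyperbolic length is at bounded distance from a hyperbolic length. -/
theorem exists_isHyperbolicLength (h : IsCoarseHyperbolicLength ℓ C) :
    ∃ (ℓ' : G → ℝ) (δ E : ℝ), IsHyperbolicLength ℓ' δ ∧ ∀ g, |ℓ' g - ℓ g| ≤ E := by
  have hC := h.const_nonneg
  -- The maximum symmetrises; the added `C` absorbs the error in the triangle inequality.
  let m : G → ℝ := fun g => max (ℓ g) (ℓ g⁻¹) + C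
  let ℓ' : G → ℝ := fun g => if g = 1 then 0 else m g
  have h1 : -C ≤ ℓ 1 := by
    have := h.mul_le 1 1
    rw [one_mul] at this
    linarith
  have m_inv : ∀ g, m g⁻¹ = m g := fun g => by simp only [m, inv_inv, max_comm]
  have m_nonneg : ∀ g, 0 ≤ m g := fun g => by
    have h2 := h.mul_le g g⁻¹
    have h3 := h.inv_le g
    rw [mul_inv_cancel] at h2
    simp only [m]
    linarith [le_max_left (ℓ g) (ℓ g⁻¹), le_max_right (ℓ g) (ℓ g⁻¹)]
  have m_mul : ∀ g k, m (g * k) ≤ m g + m k := fun g k => by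
    have h2 := h.mul_le g k
    have h3 := h.mul_le k⁻¹ g⁻¹
    rw [← mul_inv_rev] at h3
    simp only [m]
    rcases max_cases (ℓ (g * k)) (ℓ (g * k)⁻¹) with ⟨e, -⟩ | ⟨e, -⟩ <;> rw [e] <;>
    linarith [le_max_left (ℓ g) (ℓ g⁻¹), le_max_right (ℓ g) (ℓ g⁻¹),
      le_max_left (ℓ k) (ℓ k⁻¹), le_max_right (ℓ k) (ℓ k⁻¹)]
  have close : ∀ g, |ℓ' g - ℓ g| ≤ |ℓ 1| + 2 * C := fun g => by
    simp only [ℓ']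
    split_ifs with hg
    · rw [hg, zero_sub, abs_neg]; linarith
    · have h2 := h.inv_le g
      have h3 := abs_nonneg (ℓ 1)
      have h4 : max (ℓ g) (ℓ g⁻¹) ≤ ℓ g + C := max_le (by linarith) h2
      have h5 := le_max_left (ℓ g) (ℓ g⁻¹)
      rw [abs_le]
      constructor <;> simp only [m] <;> linarith
  have one : ℓ' 1 = 0 := if_pos rfl
  refine ⟨ℓ', C + 4 * (|ℓ 1| + 2 * C), |ℓ 1| + 2 * C, ⟨one, fun g => ?_, fun g k => ?_,
    fun x y z => ?_⟩, close⟩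
  · simp only [ℓ', inv_eq_one, m_inv]
  · by_cases hg : g = 1
    · rw [hg, one_mul, one, zero_add]
    by_cases hk : k = 1
    · rw [hk, mul_one, one, add_zero]
    by_cases hgk : g * k = 1
    · rw [hgk, one]
      simp only [ℓ', if_neg hg, if_neg hk]
      exact add_nonneg (m_nonneg g) (m_nonneg k)
    · simp only [ℓ', if_neg hg, if_neg hk, if_neg hgk]
      exact m_mul g k
  · have c := fun g => abs_le.1 (close g)
    rcases h.four_point x y z with H | H
    · left
      linarith [(c (x⁻¹ * y)).2, (c z).2, (c (x⁻¹ * z)).1, (c y).1]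
    · right
      linarith [(c (x⁻¹ * y)).2, (c z).2, (c (y⁻¹ * z)).1, (c x).1]

theorem exists_squaring_bound (h : IsCoarseHyperbolicLength ℓ C) (hG : SquaringBounded G) :
    ∃ L, ∀ g, ℓ (g * g) ≤ ℓ g + L := by
  obtain ⟨ℓ', δ, E, hℓ', hE⟩ := h.exists_isHyperbolicLength
  obtain ⟨L, hL⟩ := hG ℓ' δ hℓ'
  refine ⟨L + 2 * E, fun g => ?_⟩
  linarith [hL g, (abs_le.1 (hE g)).2, (abs_le.1 (hE (g * g))).1]

theorem comp {H : Type*} [Group H] (h : IsCoarseHyperbolicLength ℓ C) (φ : H →* G) :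
    IsCoarseHyperbolicLength (fun x => ℓ (φ x)) C where
  inv_le g := by simpa using h.inv_le (φ g)
  mul_le g k := by simpa using h.mul_le (φ g) (φ k)
  four_point x y z := by simpa using h.four_point (φ x) (φ y) (φ z)

/-- A coarse hyperbolic length which is bounded on the kernel of a surjection onto a group whose
hyperbolic lengths grow little under squaring also grows little under squaring. -/
theorem exists_squaring_bound_of_ker {Q : Type*} [Group Q] (h : IsCoarseHyperbolicLength ℓ C)
    {π : G →* Q} (hπ : Function.Surjective π) (hQ : SquaringBounded Q) {B : ℝ}
    (hB : ∀ k ∈ π.ker, ℓ k ≤ B) : ∃ L, ∀ g, ℓ (g * g) ≤ ℓ g + L := by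
  obtain ⟨s, hs⟩ := hπ.hasRightInverse
  -- Points of one fibre differ by a kernel element, so `ℓ ∘ s` satisfies the coarse axioms on `Q`.
  have near : ∀ {x y : G}, π x = π y → ℓ x ≤ ℓ y + (B + C) := fun {x y} hxy => by
    have h1 := h.mul_le y (y⁻¹ * x)
    have h2 := hB (y⁻¹ * x) (by simp [MonoidHom.mem_ker, hxy])
    rw [mul_inv_cancel_left] at h1
    linarith
  have n_inv : ∀ q, π (s q⁻¹) = π (s q)⁻¹ := fun q => by simp [hs _]
  have n_mul : ∀ p q, π (s (p * q)) = π (s p * s q) := fun p q => by simp [hs _]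
  have n_inv_mul : ∀ p q, π (s (p⁻¹ * q)) = π ((s p)⁻¹ * s q) := fun p q => by simp [hs _]
  have nonneg : 0 ≤ B + C := by linarith [near (rfl : π 1 = π 1)]
  have hs' : IsCoarseHyperbolicLength (fun q => ℓ (s q)) (C + 2 * (B + C)) :=
    { inv_le := fun q => by linarith [h.inv_le (s q), near (n_inv q)]
      mul_le := fun p q => by linarith [h.mul_le (s p) (s q), near (n_mul p q)]
      four_point := fun x y z => by
        have h1 := near (n_inv_mul x y)
        have h2 := near (n_inv_mul x z).symm
        have h3 := near (n_inv_mul y z).symm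
        rcases h.four_point (s x) (s y) (s z) with H | H
        · left; linarith
        · right; linarith }
  obtain ⟨L, hL⟩ := hs'.exists_squaring_bound hQ
  refine ⟨L + 2 * (B + C), fun g => ?_⟩
  have h1 : π (g * g) = π (s (π g * π g)) := by simp [hs _]
  linarith [hL (π g), near h1, near (hs (π g))]

end IsCoarseHyperbolicLength

/-! ### Quasimorphisms and Busemann functions -/

/-- The absolute value of a quasimorphism is a coarse hyperbolic length. -/
theorem isCoarseHyperbolicLength_abs {G : Type*} [Group G] {φ : G → ℝ} {D : ℝ}
    (hφ : ∀ g h, |φ (g * h) - φ g - φ h| ≤ D) :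
    IsCoarseHyperbolicLength (fun g => |φ g|) (2 * D) := by
  have h0 : 0 ≤ D := (abs_nonneg _).trans (hφ 1 1)
  have h1 : |φ 1| ≤ D := by
    have := hφ 1 1
    rwa [one_mul, sub_self, zero_sub, abs_neg] at this
  have key : ∀ x y, |φ (x⁻¹ * y) - (φ y - φ x)| ≤ D := fun x y => by
    have := hφ x (x⁻¹ * y)
    rw [mul_inv_cancel_left, abs_sub_comm] at this
    convert this using 2
  have key' : ∀ x y, |φ (x⁻¹ * y)| ≤ |φ y - φ x| + D ∧ |φ y - φ x| ≤ |φ (x⁻¹ * y)| + D :=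
    fun x y => by
      have h2 := (abs_sub_abs_le_abs_sub _ _).trans (key x y)
      have h3 := (abs_sub_abs_le_abs_sub _ _).trans ((abs_sub_comm _ _).trans_le (key x y))
      constructor <;> linarith
  refine ⟨fun g => ?_, fun g h => ?_, fun x y z => ?_⟩
  · have h2 := (key' g 1).1
    have h3 := abs_sub (φ 1) (φ g)
    rw [mul_one] at h2
    linarith
  · have h2 := abs_sub_abs_le_abs_sub (φ (g * h)) (φ g + φ h)
    rw [← sub_sub] at h2
    linarith [hφ g h, abs_add_le (φ g) (φ h)]
  · have h2 := (key' x y).1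
    have h3 := (key' x z).2
    have h4 := (key' y z).2
    -- The real line is 0-hyperbolic: the exact four-point condition for `0`, `φ x`, `φ y`, `φ z`.
    have : |φ y - φ x| + |φ z| ≤ |φ z - φ x| + |φ y| ∨
        |φ y - φ x| + |φ z| ≤ |φ z - φ y| + |φ x| := by
      rcases abs_cases (φ y - φ x) with ⟨a, a'⟩ | ⟨a, a'⟩ <;>
      rcases abs_cases (φ z - φ x) with ⟨b, b'⟩ | ⟨b, b'⟩ <;>
      rcases abs_cases (φ z - φ y) with ⟨c, c'⟩ | ⟨c, c'⟩ <;>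
      rcases abs_cases (φ x) with ⟨d, d'⟩ | ⟨d, d'⟩ <;>
      rcases abs_cases (φ y) with ⟨e, e'⟩ | ⟨e, e'⟩ <;>
      rcases abs_cases (φ z) with ⟨f, f'⟩ | ⟨f, f'⟩ <;>
      first
        | (left; linarith)
        | (right; linarith)
    rcases this with H | H
    · left; linarith
    · right; linarith

namespace IsHyperbolicLength

variable {G : Type*} [Group G] {ℓ : G → ℝ} {δ : ℝ}

/-- The Busemann function of the common limit point of the unbounded sequences in a subgroup whose
elements grow little under squaring. -/
theorem exists_busemann (h : IsHyperbolicLength ℓ δ) {K : Subgroup G} {L : ℝ} (hL : 0 ≤ L)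
    (hK : ∀ k ∈ K, ℓ (k * k) ≤ ℓ k + L) (hunb : ∀ R, ∃ k ∈ K, R ≤ ℓ k) :
    ∃ φ : G → ℝ, ∀ g, ∃ R, ∀ k ∈ K, R ≤ ℓ k → |ℓ (g⁻¹ * k) - ℓ k - φ g| ≤ δ := by
  refine ⟨fun g => ?_, fun g => ?_⟩
  -- One distant element of `K` suffices: past this threshold any two have doubled product at least
  -- `2 * ℓ g`, as `sub_le_sub_of_far` requires.
  · exact ℓ (g⁻¹ * (hunb (2 * ℓ g + (L + 2 * δ))).choose) -
      ℓ (hunb (2 * ℓ g + (L + 2 * δ))).choose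
  · set R := 2 * ℓ g + (L + 2 * δ) with hR
    obtain ⟨hm, hmR⟩ := (hunb R).choose_spec
    refine ⟨R, fun k hk hkR => ?_⟩
    set m := (hunb R).choose
    have key : ∀ a ∈ K, ∀ b ∈ K, R ≤ ℓ a → R ≤ ℓ b →
        ℓ (g⁻¹ * a) - ℓ a ≤ ℓ (g⁻¹ * b) - ℓ b + δ := fun a ha b hb haR hbR => by
      refine h.sub_le_sub_of_far ?_
      have h1 := h.min_sub_le_doubleProduct hL (hK a ha) (hK b hb) (hK _ (K.mul_mem ha hb))
      have h2 := le_min haR hbR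
      simp only [doubleProduct] at h1
      linarith
    rw [abs_le]
    constructor <;> linarith [key k hk m hm hkR hmR, key m hm k hk hmR hkR]

/-- Split `ℓ (g'⁻¹ * g⁻¹ * k) - ℓ k` at `ℓ (g⁻¹ * k)`. The point `g⁻¹ * k` need not lie in `K`, but
by normality `g⁻¹ * k * g` does, at distance `ℓ g`. Three Busemann approximations and this
replacement cost `δ` each. -/
theorem busemann_quasimorphism (h : IsHyperbolicLength ℓ δ) {K : Subgroup G} [hn : K.Normal]
    (hunb : ∀ R, ∃ k ∈ K, R ≤ ℓ k) {φ : G → ℝ}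
    (hφ : ∀ g, ∃ R, ∀ k ∈ K, R ≤ ℓ k → |ℓ (g⁻¹ * k) - ℓ k - φ g| ≤ δ) (g g' : G) :
    |φ (g * g') - φ g - φ g'| ≤ 4 * δ := by
  obtain ⟨R₁, h₁⟩ := hφ g
  obtain ⟨R₂, h₂⟩ := hφ g'
  obtain ⟨R₃, h₃⟩ := hφ (g * g')
  obtain ⟨k, hk, hkR⟩ := hunb (max (max R₁ R₃) (max (R₂ + 2 * ℓ g) (ℓ g' + 3 * ℓ g)))
  simp only [max_le_iff] at hkR
  obtain ⟨⟨r1, r3⟩, r2, r4⟩ := hkR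
  set k' := g⁻¹ * k * g with hk'
  have hmem : k' ∈ K := by simpa using hn.conj_mem k hk g⁻¹
  have e1 : k' * g⁻¹ = g⁻¹ * k := by rw [hk']; group
  have l1 : ℓ k ≤ ℓ k' + 2 * ℓ g := by
    have a := h.mul_le (g * k') g⁻¹
    have b := h.mul_le g k'
    rw [show g * k' * g⁻¹ = k by rw [hk']; group, h.inv] at a
    linarith
  have l2 : ℓ k' ≤ ℓ (g⁻¹ * k) + ℓ g := h.mul_le (g⁻¹ * k) g
  have e2 : ℓ ((g⁻¹ * k)⁻¹ * k') = ℓ g := by rw [hk']; congr 1; group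
  have e3 : ℓ (k'⁻¹ * (g⁻¹ * k)) = ℓ g := by rw [← h.inv, ← e2]; congr 1; group
  have a1 := abs_le.1 (h₁ k hk r1)
  have a2 := abs_le.1 (h₂ k' hmem (by linarith))
  have a3 := abs_le.1 (h₃ k hk r3)
  have b1 := h.sub_le_sub_of_far (g := g') (u := g⁻¹ * k) (v := k') (by linarith)
  have b2 := h.sub_le_sub_of_far (g := g') (u := k') (v := g⁻¹ * k) (by linarith)
  rw [show (g * g')⁻¹ * k = g'⁻¹ * (g⁻¹ * k) by group] at a3
  rw [abs_le]
  constructor <;> linarith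

/-- For a high power `x` of `g`, a distant `k` has bounded product with `x` or with `x⁻¹`, since
these two have bounded product with each other. At that one, `φ` is at least `ℓ x` minus a constant.
-/
theorem exists_lt_abs_busemann (h : IsHyperbolicLength ℓ δ) {K : Subgroup G}
    (hunb : ∀ R, ∃ k ∈ K, R ≤ ℓ k) {φ : G → ℝ}
    (hφ : ∀ g, ∃ R, ∀ k ∈ K, R ≤ ℓ k → |ℓ (g⁻¹ * k) - ℓ k - φ g| ≤ δ) {g : G}
    (hg : ℓ g + (2 * δ + 1) < ℓ (g * g)) (B : ℝ) : ∃ x, B < |φ x| := by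
  have h0 := h.const_nonneg
  obtain ⟨n, hn⟩ := exists_nat_gt (B + ℓ g + 4 * δ)
  have hlen : B + ℓ g + 4 * δ < ℓ (g ^ (n + 1)) := by
    have h1 := h.pow_ge (by linarith) hg (n + 1)
    have h2 : (0 : ℝ) ≤ ((n + 1 : ℕ) : ℝ) * δ := by positivity
    push_cast at h1 h2
    linarith
  set x := g ^ (n + 1) with hx
  obtain ⟨R, hR⟩ := hφ x
  obtain ⟨R', hR'⟩ := hφ x⁻¹
  obtain ⟨k, hk, hkR⟩ := hunb (max R R')
  have a := abs_le.1 (hR k hk ((le_max_left _ _).trans hkR))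
  have b := abs_le.1 (hR' k hk ((le_max_right _ _).trans hkR))
  have p := h.doubleProduct_pow_le (by linarith) hg n n
  rw [← hx] at p
  have q := h.doubleProduct_comm k x
  have hi := h.inv x
  rcases h.doubleProduct_ge x⁻¹ k x with H | H <;> simp only [doubleProduct] at p q H
  · exact ⟨x⁻¹, lt_of_lt_of_le (by linarith) (le_abs_self _)⟩
  · exact ⟨x, lt_of_lt_of_le (by linarith) (le_abs_self _)⟩

end IsHyperbolicLength

/-! ### Extensions -/

/-- Stability under extensions of the bounded growth of hyperbolic lengths under squaring. -/
theorem SquaringBounded.of_extension {N G Q : Type*} [Group N] [Group G] [Group Q]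
    {ι : N →* G} {π : G →* Q} (hι : ι.range = π.ker) (hπ : Function.Surjective π)
    (hN : SquaringBounded N) (hQ : SquaringBounded Q) : SquaringBounded G := by
  intro ℓ δ h
  have h0 := h.const_nonneg
  have hker : ∀ k ∈ π.ker, ∃ n, ι n = k := fun k hk => by rwa [← hι] at hk
  by_cases hb : ∃ B, ∀ k ∈ π.ker, ℓ k ≤ B
  · obtain ⟨B, hB⟩ := hb
    have hc : IsCoarseHyperbolicLength ℓ δ :=
      ⟨fun g => by linarith [h.inv g], fun g k => by linarith [h.mul_le g k], h.four_point⟩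
    exact hc.exists_squaring_bound_of_ker hπ hQ hB
  · push Not at hb
    have hunb : ∀ R, ∃ k ∈ π.ker, R ≤ ℓ k := fun R =>
      (hb R).imp fun k hk => ⟨hk.1, hk.2.le⟩
    obtain ⟨L, hL⟩ := hN _ δ (h.comp ι)
    obtain ⟨φ, hφ⟩ := h.exists_busemann (le_max_right L 0) (K := π.ker) (fun k hk => by
      obtain ⟨n, rfl⟩ := hker k hk
      have := hL n
      rw [map_mul] at this
      linarith [le_max_left L 0]) hunb
    have hq := h.busemann_quasimorphism hunb hφ
    have hc := isCoarseHyperbolicLength_abs hq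
    have double : ∀ g, 2 * |φ g| ≤ |φ (g * g)| + 4 * δ := fun g => by
      have h1 := abs_sub_abs_le_abs_sub (φ g + φ g) (φ (g * g))
      rw [← two_mul, abs_mul, abs_two, two_mul (φ g), abs_sub_comm, ← sub_sub] at h1
      linarith [hq g g]
    obtain ⟨L₁, hL₁⟩ := (hc.comp ι).exists_squaring_bound hN
    -- On the kernel, `2 * |φ k| ≤ |φ (k * k)| + 4 * δ ≤ |φ k| + L₁ + 4 * δ`, which gives `B`.
    obtain ⟨L₂, hL₂⟩ := hc.exists_squaring_bound_of_ker hπ hQ (B := L₁ + 4 * δ) fun k hk => by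
      obtain ⟨n, rfl⟩ := hker k hk
      have := hL₁ n
      simp only [map_mul] at this
      linarith [double (ι n)]
    refine ⟨2 * δ + 1, fun g => ?_⟩
    by_contra! hg
    obtain ⟨x, hx⟩ := h.exists_lt_abs_busemann hunb hφ hg (L₂ + 4 * δ)
    linarith [hL₂ x, double x]

/-! ### Equivalence with (NL), and the main theorem -/

theorem PropertyNL.squaringBounded {G : Type u} [Group G] (hG : PropertyNL G) :
    SquaringBounded G := by
  intro ℓ δ h
  have h0 := h.const_nonneg
  -- With this bound a violating `g` has `ℓ (g ^ n) ≥ n * (δ + 1) ≥ n`, a linear lower bound even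
  -- when `δ = 0`.
  refine ⟨2 * δ + 1, fun g => ?_⟩
  by_contra! hg
  let _ : PseudoMetricSpace G :=
    { dist := fun x y => ℓ (x⁻¹ * y)
      dist_self := fun x => by simp [h.one]
      dist_comm := fun x y => h.inv_mul_comm x y
      dist_triangle := fun x y z => by
        have := h.mul_le (x⁻¹ * y) (y⁻¹ * z)
        rwa [show x⁻¹ * y * (y⁻¹ * z) = x⁻¹ * z by group] at this }
  have dist_eq : ∀ x y : G, dist x y = ℓ (x⁻¹ * y) := fun _ _ => rfl
  have : IsIsometricSMul G G := ⟨fun c => Isometry.of_dist_eq fun x y => by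
    simp only [dist_eq, smul_eq_mul]
    congr 1
    group⟩
  have hyp : IsHyperbolicSpace (TightSpan G) := by
    refine TightSpan.isHyperbolicSpace h0 fun x y z w => ?_
    have H := h.four_point (w⁻¹ * x) (w⁻¹ * y) (w⁻¹ * z)
    have e : ∀ a b : G, (w⁻¹ * a)⁻¹ * (w⁻¹ * b) = a⁻¹ * b := fun a b => by group
    simp only [e, ← dist_eq, dist_comm w] at H
    rcases H with H | H
    · linarith [le_max_left (dist x z + dist y w) (dist y z + dist x w)]
    · linarith [le_max_right (dist x z + dist y w) (dist y z + dist x w)]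
  refine hG (TightSpan G) hyp g ⟨TightSpan.kuratowski 1, ?_⟩
  have upper : ∀ n : ℕ, ℓ (g ^ n) ≤ n * ℓ g := fun n => by
    induction n with
    | zero => simp [h.one]
    | succ n ih =>
      have := h.mul_le (g ^ n) g
      rw [pow_succ]
      push_cast
      linarith
  have abs_pow : ∀ n : ℤ, ℓ (g ^ n) = ℓ (g ^ n.natAbs) := fun n => by
    rcases Int.natAbs_eq n with e | e
    · conv_lhs => rw [e, zpow_natCast]
    · conv_lhs => rw [e, zpow_neg, zpow_natCast, h.inv]
  refine ⟨max 1 (ℓ g), 0, le_max_left _ _, le_rfl, fun a b => ?_⟩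
  have e : dist (g ^ a • TightSpan.kuratowski (1 : G)) (g ^ b • TightSpan.kuratowski (1 : G)) =
      ℓ (g ^ (b - a).natAbs) := by
    rw [TightSpan.smul_kuratowski, TightSpan.smul_kuratowski, TightSpan.dist_kuratowski, dist_eq,
      ← abs_pow, smul_eq_mul, smul_eq_mul, mul_one, mul_one, ← zpow_neg, ← zpow_add,
      neg_add_eq_sub]
  have e' : dist a b = ((b - a).natAbs : ℝ) := by
    rw [dist_comm, Int.dist_eq, Nat.cast_natAbs]
    push_cast
    rfl
  simp only [e, e']
  generalize (b - a).natAbs = n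
  have hn : (0 : ℝ) ≤ n := n.cast_nonneg
  constructor
  · have h1 := h.pow_ge (by linarith) hg n
    have h2 : (max 1 (ℓ g))⁻¹ * (n : ℝ) ≤ n :=
      mul_le_of_le_one_left hn (inv_le_one_of_one_le₀ (le_max_left _ _))
    have h3 : (0 : ℝ) ≤ n * δ := by positivity
    linarith
  · have := mul_le_mul_of_nonneg_left (le_max_right 1 (ℓ g)) hn
    linarith [upper n]

theorem SquaringBounded.propertyNL {G : Type u} [Group G] (hG : SquaringBounded G) :
    PropertyNL G := by
  intro X _ _ _ ⟨_, δ, _, hX⟩ g ⟨x, K, C, hK, _, hf⟩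
  have trans_eq : ∀ a b : G, dist (a • x) (b • x) = dist ((a⁻¹ * b) • x) x := fun a b => by
    rw [← dist_smul a⁻¹, inv_smul_smul, smul_smul, dist_comm]
  -- Clearing the halves in the Gromov products doubles `δ`.
  obtain ⟨L, hL⟩ := hG (fun a => dist (a • x) x) (2 * δ)
    { one := by simp
      inv := fun a => by rw [← dist_smul a, smul_inv_smul, dist_comm]
      mul_le := fun a b => by
        have := dist_triangle ((a * b) • x) (a • x) x
        rw [mul_smul, dist_smul] at this
        rw [mul_smul]
        linarith
      four_point := fun a b c => by
        have := hX x (a • x) (c • x) (b • x)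
        simp only [gromovProduct, tsub_le_iff_right, min_le_iff, trans_eq] at this
        have e := trans_eq b c
        have e' := trans_eq c b
        rw [dist_comm] at e'
        rcases this with H | H
        · left; linarith
        · right; linarith }
  have pow_le : ∀ i : ℕ, dist (g ^ 2 ^ i • x) x ≤ dist (g • x) x + i * L := fun i => by
    induction i with
    | zero => simp
    | succ i ih =>
      have := hL (g ^ 2 ^ i)
      simp only [← pow_add, ← two_mul, ← pow_succ'] at this
      push_cast
      linarith
  have pow_ge : ∀ i : ℕ, K⁻¹ * 2 ^ i - C ≤ dist (g • x) x + i * L := fun i => by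
    have := (hf (2 ^ i : ℕ) 0).1
    simp only [zpow_natCast, zpow_zero, one_smul, Int.dist_eq] at this
    push_cast at this
    rw [sub_zero, abs_of_pos (by positivity)] at this
    exact this.trans (pow_le i)
  have hK' : 0 < K⁻¹ := inv_pos.2 (by linarith)
  have lim : Filter.Tendsto (fun i : ℕ => (i : ℝ) / 2 ^ i * L + (dist (g • x) x + C) / 2 ^ i)
      Filter.atTop (nhds (0 * L + 0)) := by
    refine Filter.Tendsto.add (Filter.Tendsto.mul_const L ?_) ?_
    · simpa using tendsto_pow_const_div_const_pow_of_one_lt 1 (one_lt_two (α := ℝ))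
    · exact tendsto_const_nhds.div_atTop (tendsto_pow_atTop_atTop_of_one_lt one_lt_two)
  rw [zero_mul, add_zero] at lim
  obtain ⟨i, hi⟩ := (lim.eventually_lt_const hK').exists
  have hp : (0 : ℝ) < 2 ^ i := by positivity
  have : (i * L + (dist (g • x) x + C)) / 2 ^ i < K⁻¹ := by
    refine lt_of_eq_of_lt ?_ hi
    ring
  rw [div_lt_iff₀ hp] at this
  linarith [pow_ge i]

theorem PropertyNL.of_extension {N G Q : Type u} [Group N] [Group G] [Group Q]
    {ι : N →* G} {π : G →* Q} (hι : ι.range = π.ker) (hπ : Function.Surjective π)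
    (hN : PropertyNL N) (hQ : PropertyNL Q) : PropertyNL G :=
  (SquaringBounded.of_extension hι hπ hN.squaringBounded hQ.squaringBounded).propertyNL

theorem mainTheorem7 {N G Q : Type u} [Group N] [Group G] [Group Q]
    (S : GroupExtension N G Q) :
    (PropertyNL N → PropertyNL Q → PropertyNL G) ∧
      (HereditaryNL N → HereditaryNL Q → HereditaryNL G) := by
  refine ⟨PropertyNL.of_extension S.range_inl_eq_ker_rightHom S.rightHom_surjective,
    fun hN hQ H hH => ?_⟩
  -- Restrict the extension to `H`: its kernel is the preimage of `H` in `N` and its quotient the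
  -- image in `Q`, both of finite index.
  refine PropertyNL.of_extension (ι := S.inl.subgroupComap H) (π := S.rightHom.subgroupMap H) ?_
    (S.rightHom.subgroupMap_surjective H) (hN _ ?_) (hQ _ ?_)
  · rw [Subgroup.ker_subgroupMap, ← S.range_inl_eq_ker_rightHom]
    ext ⟨g, hg⟩
    simp only [Subgroup.mem_subgroupOf, MonoidHom.mem_range]
    constructor
    · rintro ⟨n, hn⟩
      exact ⟨n, congrArg Subtype.val hn⟩
    · rintro ⟨n, rfl⟩
      exact ⟨⟨n, hg⟩, rfl⟩
  · refine ⟨fun h => ?_⟩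
    rw [Subgroup.index_comap] at h
    exact (Subgroup.isFiniteRelIndex_of_finiteIndex (H := H) (K := S.inl.range)).relIndex_ne_zero h
  · refine ⟨ne_zero_of_dvd_ne_zero hH.index_ne_zero ?_⟩
    exact Subgroup.index_map_dvd _ S.rightHom_surjective
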